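/- Let $A$ be a finite alphabet and let $L\subseteq A^*$ be a language. For $m>1$, let $\mathrm{FO}[<,\equiv_m]$ be the class of languages over $A$ that are defined by a first-order sentence whose variables range over the positions of a word and whose atomic predicates are $Q_ax$ ("the letter in position $x$ is $a$", for $a\in A$), $x<y$ ("position $x$ is strictly to the left of position $y$"), equality, and $x\equiv_m y$ ("positions $x$ and $y$ are congruent modulo $m$"). The empty word is allowed; its set of positions is empty. Let $\eta_L\colon A^*\to\mathrm{Synt}(L)$ be the syntactic morphism of $L$, that is, the quotient map of $A^*$ by the congruence $u\sim_L v \iff (\forall x,y\in A^*)\,(xuy\in L\Leftrightarrow xvy\in L)$. For a morphism $\phi\colon A^*\to M$ into a finite monoid there is exactly one set of the form $\phi(A^s)$ with $s>0$ and $\phi(A^s)=\phi(A^{2s})$; it is a subsemigroup of $M$, called the stable semigroup of $\phi$. Let $\mathbf{QA}$ be the class of morphisms $\phi$ from $A^*$ onto a finite monoid whose stable semigroup is aperiodic, that is, satisfies $x\,x^{\omega}=x^{\omega}$ for each of its elements $x$, where $x^\omega$ is the idempotent power of $x$ (equivalently, it contains no nontrivial group). Theorem. The language $L$ belongs to $\mathrm{FO}[<,\equiv_m]$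 for some $m>1$ if and only if $\eta_L\in\mathbf{QA}$, that is, if and only if $\mathrm{Synt}(L)$ is finite and the stable semigroup of $\eta_L$ is aperiodic. -/

import Mathlib

/-! ### First-order logic on words -/

/-- The relation symbols of the logic: a unary symbol `Q_a` for every letter `a`, the binary
symbol `<`, and the binary symbol `≡`. -/
inductive WordRel (A : Type*) : ℕ → Type _
  | letter (a : A) : WordRel A 1
  | lt : WordRel A 2
  | modEq : WordRel A 2

/-- The relational first-order signature with symbols `Q_a` (`a ∈ A`), `<` and `≡`. -/
def wordSignature (A : Type*) : FirstOrder.Language :=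
  ⟨fun _ => Empty, WordRel A⟩

/-- The interpretation of the signature on the positions of the word `w`: `Q_a x` says that the
letter at position `x` is `a`, `x < y` that `x` is strictly to the left of `y`, and `x ≡ y` that the
two positions are congruent modulo `m`. (Positions are numbered from `0` here, which does not
affect the congruence of two positions.) The empty word gives the empty structure. -/
@[reducible] def wordStructure {A : Type*} (m : ℕ) (w : List A) :
    (wordSignature A).Structure (Fin w.length) where
  funMap := fun {_} f => Empty.elim f
  RelMap := fun {_} r =>
    match r with
    | WordRel.letter a => fun x => w.get (x 0) = a
    | WordRel.lt => fun x => x 0 < x 1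
    | WordRel.modEq => fun x => (x 0 : ℕ) ≡ (x 1 : ℕ) [MOD m]

/-- The word `w` satisfies the sentence `φ`, with `≡` read as congruence modulo `m`. -/
def WordSatisfies {A : Type*} (m : ℕ) (w : List A) (φ : (wordSignature A).Sentence) : Prop :=
  @FirstOrder.Language.Sentence.Realize (wordSignature A) (Fin w.length) (wordStructure m w) φ

/-- The class `FO[<, ≡_m]` of languages over `A`: those defined by a first-order sentence over
the predicates `Q_a`, `<` and `≡_m`. -/
def FOLtMod (A : Type*) (m : ℕ) : Set (Language A) :=
  {L | ∃ φ : (wordSignature A).Sentence, ∀ w : List A, w ∈ L ↔ WordSatisfies m w φ}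

/-! ### Syntactic morphisms -/

/-- The syntactic congruence of a language: `u` and `v` are congruent when
`x u y ∈ L ↔ x v y ∈ L` for all words `x`, `y`. -/
def syntacticCon {A : Type*} (L : Language A) : Con (FreeMonoid A) where
  r u v := ∀ x y : FreeMonoid A,
    FreeMonoid.toList (x * u * y) ∈ L ↔ FreeMonoid.toList (x * v * y) ∈ L
  iseqv :=
    ⟨fun _ _ _ => Iff.rfl, fun h x y => (h x y).symm, fun h k x y => (h x y).trans (k x y)⟩
  mul' := by
    intro u u' v v' h k x y
    have h₁ := h x (v * y)
    have h₂ := k (x * u') y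
    simp only [mul_assoc] at h₁ h₂ ⊢
    exact h₁.trans h₂

/-- The syntactic monoid of a language. -/
abbrev SyntacticMonoid {A : Type*} (L : Language A) : Type _ := (syntacticCon L).Quotient

/-- The syntactic morphism `η_L` of a language. -/
def syntacticMorphism {A : Type*} (L : Language A) : FreeMonoid A →* SyntacticMonoid L :=
  (syntacticCon L).mk'

/-! ### Stable semigroups and quasi-aperiodic morphisms -/

/-- The set `φ(A^s)` of the images of the words of length `s`. -/
def lengthImage {A M : Type*} [Monoid M] (φ : FreeMonoid A →* M) (s : ℕ) : Set M :=
  φ '' {w | w.length = s}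

open scoped Pointwise in
theorem lengthImage_eq_pow {A M : Type*} [Monoid M] (φ : FreeMonoid A →* M) (s : ℕ) :
    lengthImage φ s = lengthImage φ 1 ^ s := by
  induction s with
  | zero =>
    ext x
    simp [lengthImage]
  | succ s ih =>
    rw [pow_succ', ← ih]
    ext x
    simp only [lengthImage, Set.mem_image, Set.mem_ofPred_eq, Set.mem_mul]
    constructor
    · rintro ⟨w, hw, rfl⟩
      induction w using FreeMonoid.casesOn with
      | one => simp at hw
      | of_mul a w =>
        refine ⟨_, ⟨FreeMonoid.of a, by simp, rfl⟩, _, ⟨w, ?_, rfl⟩, by simp⟩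
        simp at hw
        omega
    · rintro ⟨_, ⟨u, hu, rfl⟩, _, ⟨v, hv, rfl⟩, rfl⟩
      exact ⟨u * v, by simp [hu, hv, add_comm], by simp⟩

/-- `S` is a stable semigroup of `φ`: `S = φ(A^s)` for some `s > 0` with `φ(A^s) = φ(A^(2s))`. -/
def IsStableSemigroup {A M : Type*} [Monoid M] (φ : FreeMonoid A →* M) (S : Subsemigroup M) :
    Prop :=
  ∃ s : ℕ, 0 < s ∧ lengthImage φ s = lengthImage φ (2 * s) ∧ (S : Set M) = lengthImage φ s

open scoped Pointwise in
/-- A morphism into a finite monoid has exactly one stable semigroup. -/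
theorem existsUnique_isStableSemigroup {A M : Type*} [Monoid M] [Finite M]
    (φ : FreeMonoid A →* M) : ∃! S : Subsemigroup M, IsStableSemigroup φ S := by
  set P := lengthImage φ 1 with hP
  have hpow : ∀ s, lengthImage φ s = P ^ s := lengthImage_eq_pow φ
  have hex : ∃ s, 0 < s ∧ P ^ s = P ^ (2 * s) := by
    obtain ⟨a, b, hne, hab⟩ := Finite.exists_ne_map_eq_of_infinite (fun n : ℕ => P ^ n)
    wlog hlt : a < b generalizing a b
    · exact this b a hne.symm hab.symm (by omega)
    obtain ⟨p, rfl⟩ := Nat.exists_eq_add_of_lt hlt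
    have hper : ∀ k, P ^ (a + k * (p + 1)) = P ^ a := by
      intro k
      induction k with
      | zero => simp
      | succ k ih =>
        have : a + (k + 1) * (p + 1) = (a + k * (p + 1)) + (p + 1) := by ring
        rw [this, pow_add, ih, ← pow_add]
        exact hab.symm
    refine ⟨(a + 1) * (p + 1), by positivity, ?_⟩
    obtain ⟨c, hc⟩ : ∃ c, (a + 1) * (p + 1) = a + c := ⟨a * p + p + 1, by ring⟩
    have : 2 * ((a + 1) * (p + 1)) = (a + (a + 1) * (p + 1)) + c := by omega
    rw [this, pow_add, hper, ← pow_add, hc]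
  have hmul : ∀ s, P ^ s = P ^ (2 * s) → ∀ k, 0 < k → P ^ (s * k) = P ^ s := by
    intro s hs k hk
    have hidem : IsIdempotentElem (P ^ s) := by
      change P ^ s * P ^ s = P ^ s
      rw [← pow_add, ← two_mul, ← hs]
    rw [pow_mul, hidem.pow_eq hk.ne']
  obtain ⟨s, hs0, hs⟩ := hex
  refine ⟨⟨P ^ s, ?_⟩, ⟨s, hs0, by rw [hpow, hpow, hs], (hpow s).symm⟩, ?_⟩
  · intro x y hx hy
    rw [hs, two_mul, pow_add]
    exact Set.mul_mem_mul hx hy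
  · rintro T ⟨t, ht0, ht, hT⟩
    apply SetLike.coe_injective
    rw [hT, hpow]
    rw [hpow, hpow] at ht
    change P ^ t = P ^ s
    rw [← hmul s hs t ht0, mul_comm, hmul t ht s hs0]

/-- The stable semigroup of a morphism into a finite monoid. -/
noncomputable def stableSemigroup {A M : Type*} [Monoid M] [Finite M] (φ : FreeMonoid A →* M) :
    Subsemigroup M :=
  (existsUnique_isStableSemigroup φ).choose

/-- Aperiodicity of a subsemigroup `S` of a finite monoid: every `x ∈ S` satisfies
`x * x ^ ω = x ^ ω`, where `x ^ ω` is the idempotent power of `x`. -/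
def IsAperiodic {M : Type*} [Monoid M] (S : Subsemigroup M) : Prop :=
  ∀ x ∈ S, ∀ n : ℕ, 0 < n → IsIdempotentElem (x ^ n) → x * x ^ n = x ^ n

/-- Membership of a morphism `φ : A^* → M` in the class `QA`: `M` is finite, `φ` is surjective and
the stable semigroup of `φ` is aperiodic. -/
def IsQA {A M : Type*} [Monoid M] (φ : FreeMonoid A →* M) : Prop :=
  Function.Surjective φ ∧ ∃ _ : Finite M, IsAperiodic (stableSemigroup φ)

/-! Both directions compare languages with the equivalences `RankEquiv k` on words whose letters
carry their position modulo `m`. Choosing a position cuts a word into two factors that no longer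
interact, so the Ehrenfeucht–Fraïssé game becomes a recursion on factorizations. For each `k` it
gives a congruence of finite index for which all powers of a word with exponent at least `2 ^ k - 1`
are equivalent.

Necessity: a sentence cannot separate labelled words that are equivalent of a suitable rank
(`exists_wordSatisfies_iff`). Hence `Synt(L)` is finite. If `m` divides the length of `w`, labelling
commutes with taking powers of `w`, so the powers of `η(w)` stabilize; every element of the stable
semigroup is such an `η(w)`.

Sufficiency: for `m` a multiple of a stable length `s`, labelled letters act as partial maps on
`Synt(L) × ZMod m`. They generate an aperiodic monoid: a word whose length is not divisible by `m`
acts with empty square, and any other nonempty word acts, where defined, by left multiplication by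
an element of the stable semigroup. Schützenberger's theorem, proved with local divisors
(`exists_prod_eq_of_rankEquiv`), shows that this action, and so `η(w)`, depends only on the class of
the labelled `w`. These classes are finitely many and definable. -/

/-- Two words are equivalent of rank `k + 1` when every factorization `u₁ c u₂` of one of them, with
`c` a letter, is matched by a factorization `v₁ c v₂` of the other one, with `u₁`, `v₁` and `u₂`, `v₂`
equivalent of rank `k`. This is the Ehrenfeucht–Fraïssé equivalence of words. -/
def RankEquiv {C : Type*} : ℕ → List C → List C → Prop
  | 0, _, _ => True
  | k + 1, u, v =>
    (∀ u₁ c u₂, u = u₁ ++ c :: u₂ →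
      ∃ v₁ v₂, v = v₁ ++ c :: v₂ ∧ RankEquiv k u₁ v₁ ∧ RankEquiv k u₂ v₂) ∧
    (∀ v₁ c v₂, v = v₁ ++ c :: v₂ →
      ∃ u₁ u₂, u = u₁ ++ c :: u₂ ∧ RankEquiv k v₁ u₁ ∧ RankEquiv k v₂ u₂)

/-! ### Ehrenfeucht–Fraïssé equivalence as a congruence of finite index. -/

namespace RankEquiv

universe u

variable {C D : Type*}

theorem symm {k : ℕ} {u v : List C} (h : RankEquiv k u v) : RankEquiv k v u := by
  cases k with
  | zero => trivial
  | succ k => exact ⟨h.2, h.1⟩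

/-- To relate a symmetric family of pairs of words it is enough to match factorizations of the
first word of each pair. -/
theorem succ_of_symm {k : ℕ} {R : List C → List C → Prop} (hR : ∀ u v, R u v → R v u)
    (h : ∀ u₁ c u₂ v, R (u₁ ++ c :: u₂) v →
      ∃ v₁ v₂, v = v₁ ++ c :: v₂ ∧ RankEquiv k u₁ v₁ ∧ RankEquiv k u₂ v₂)
    {u v : List C} (huv : R u v) : RankEquiv (k + 1) u v :=
  ⟨fun u₁ c u₂ e => h u₁ c u₂ v (e ▸ huv), fun v₁ c v₂ e => h v₁ c v₂ u (e ▸ hR _ _ huv)⟩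

theorem refl (k : ℕ) (u : List C) : RankEquiv k u u := by
  induction k generalizing u with
  | zero => trivial
  | succ k ih =>
    exact succ_of_symm (R := Eq) (fun _ _ => Eq.symm)
      (fun u₁ c u₂ v e => ⟨u₁, u₂, e.symm, ih _, ih _⟩) rfl

theorem of_succ {k : ℕ} {u v : List C} (h : RankEquiv (k + 1) u v) : RankEquiv k u v := by
  induction k generalizing u v with
  | zero => trivial
  | succ k ih =>
    refine succ_of_symm (R := RankEquiv (k + 2)) (fun _ _ => symm) ?_ h
    intro u₁ c u₂ v h
    obtain ⟨v₁, v₂, e, h₁, h₂⟩ := h.1 _ _ _ rfl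
    exact ⟨v₁, v₂, e, ih h₁, ih h₂⟩

theorem mono {k l : ℕ} (hkl : k ≤ l) {u v : List C} (h : RankEquiv l u v) : RankEquiv k u v := by
  induction l, hkl using Nat.le_induction with
  | base => exact h
  | succ l _ ih => exact ih h.of_succ

/-- The chosen letter lies in one of the two factors and is answered there; the other factor is
carried along whole, at a rank lowered by one. -/
theorem append {k : ℕ} {u u' v v' : List C} (h : RankEquiv k u u') (h' : RankEquiv k v v') :
    RankEquiv k (u ++ v) (u' ++ v') := by
  induction k generalizing u u' v v' with
  | zero => trivial
  | succ k ih =>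
    refine succ_of_symm (R := fun w w' => ∃ u u' v v', w = u ++ v ∧ w' = u' ++ v' ∧
      RankEquiv (k + 1) u u' ∧ RankEquiv (k + 1) v v')
      (fun w w' ⟨u, u', v, v', e, e', h, h'⟩ => ⟨u', u, v', v, e', e, h.symm, h'.symm⟩)
      ?_ ⟨u, u', v, v', rfl, rfl, h, h'⟩
    rintro w₁ c w₂ w' ⟨u, u', v, v', e, rfl, h, h'⟩
    rcases List.append_eq_append_iff.1 e.symm with ⟨t, rfl, et⟩ | ⟨t, rfl, et⟩
    · obtain ⟨v₁, v₂, rfl, h₁, h₂⟩ := h'.1 _ _ _ et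
      exact ⟨u' ++ v₁, v₂, by simp, ih h.of_succ h₁, h₂⟩
    -- If `t` is empty, then `w₁` is all of `u` and `c` is the first letter of `v`.
    · cases t with
      | nil =>
        obtain ⟨v₁, v₂, rfl, h₁, h₂⟩ := h'.1 [] c w₂ (by simpa using et.symm)
        exact ⟨u' ++ v₁, v₂, by simp, by simpa using ih h.of_succ h₁, h₂⟩
      | cons d t =>
        obtain ⟨rfl, rfl⟩ : c = d ∧ w₂ = t ++ v := by simpa using et
        obtain ⟨u₁, u₂, rfl, h₁, h₂⟩ := h.1 _ _ _ rfl
        exact ⟨u₁, u₂ ++ v', by simp, h₁, ih h₂ h'.of_succ⟩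

theorem map {k : ℕ} (f : C → D) {u v : List C} (h : RankEquiv k u v) :
    RankEquiv k (u.map f) (v.map f) := by
  induction k generalizing u v with
  | zero => trivial
  | succ k ih =>
    refine succ_of_symm
      (R := fun u' v' => ∃ u v, u' = u.map f ∧ v' = v.map f ∧ RankEquiv (k + 1) u v)
      (fun _ _ ⟨u, v, e, e', h⟩ => ⟨v, u, e', e, h.symm⟩) ?_ ⟨u, v, rfl, rfl, h⟩
    rintro w₁ c w₂ _ ⟨u, v, e, rfl, h⟩
    obtain ⟨u₁, u₂', rfl, rfl, e₂⟩ := List.map_eq_append_iff.1 e.symm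
    obtain ⟨d, u₂, rfl, rfl, rfl⟩ := List.map_eq_cons_iff.1 e₂
    obtain ⟨v₁, v₂, rfl, h₁, h₂⟩ := h.1 _ _ _ rfl
    exact ⟨v₁.map f, v₂.map f, by simp, ih h₁, ih h₂⟩

theorem mem {k : ℕ} {u v : List C} (h : RankEquiv (k + 1) u v) {c : C} (hc : c ∈ u) : c ∈ v := by
  obtain ⟨u₁, u₂, rfl⟩ := List.append_of_mem hc
  obtain ⟨v₁, v₂, rfl, -, -⟩ := h.1 _ _ _ rfl
  simp

theorem mem_iff {k : ℕ} {u v : List C} (h : RankEquiv (k + 1) u v) {c : C} : c ∈ u ↔ c ∈ v :=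
  ⟨h.mem, h.symm.mem⟩

/-- Over a finite alphabet there are finitely many words up to equivalence of rank `k`. -/
theorem exists_finite_classifier (C : Type u) [Finite C] (k : ℕ) :
    ∃ (T : Type u) (_ : Finite T) (f : List C → T), ∀ u v, f u = f v → RankEquiv k u v := by
  induction k with
  | zero => exact ⟨PUnit, inferInstance, fun _ => PUnit.unit, fun _ _ _ => trivial⟩
  | succ k ih =>
    obtain ⟨T, _, f, hf⟩ := ih
    let g : List C → Set (T × C × T) := fun u => {t | ∃ u₁ c u₂, u = u₁ ++ c :: u₂ ∧
      t = (f u₁, c, f u₂)}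
    refine ⟨Set (T × C × T), inferInstance, g, fun u v h => ?_⟩
    refine succ_of_symm (R := fun u v => g u = g v) (fun _ _ => Eq.symm) ?_ h
    intro u₁ c u₂ v h
    have : (f u₁, c, f u₂) ∈ g v := h ▸ ⟨u₁, c, u₂, rfl, rfl⟩
    obtain ⟨v₁, d, v₂, rfl, e⟩ := this
    simp only [Prod.mk.injEq] at e
    obtain ⟨e₁, rfl, e₂⟩ := e
    exact ⟨v₁, v₂, rfl, hf _ _ e₁, hf _ _ e₂⟩

/-- A factorization of a power of a word factors one of the copies of the word. -/
theorem exists_of_flatten_replicate_eq {u : List C} {n : ℕ} {w₁ w₂ : List C} {c : C}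
    (h : (List.replicate n u).flatten = w₁ ++ c :: w₂) :
    ∃ i j u₁ u₂, n = i + j + 1 ∧ u = u₁ ++ c :: u₂ ∧
      w₁ = (List.replicate i u).flatten ++ u₁ ∧ w₂ = u₂ ++ (List.replicate j u).flatten := by
  induction n generalizing w₁ with
  | zero => simp at h
  | succ n ih =>
    rw [List.replicate_succ, List.flatten_cons] at h
    have next : ∀ t, w₁ = u ++ t → (List.replicate n u).flatten = t ++ c :: w₂ →
        ∃ i j u₁ u₂, n + 1 = i + j + 1 ∧ u = u₁ ++ c :: u₂ ∧
          w₁ = (List.replicate i u).flatten ++ u₁ ∧ w₂ = u₂ ++ (List.replicate j u).flatten := by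
      intro t e et
      obtain ⟨i, j, u₁, u₂, rfl, hu, ht, hw⟩ := ih et
      exact ⟨i + 1, j, u₁, u₂, by omega, hu, by simp [e, ht, List.replicate_succ], hw⟩
    rcases List.append_eq_append_iff.1 h with ⟨t, e, et⟩ | ⟨t, e, et⟩
    · exact next t e et
    · cases t with
      | nil => exact next [] (by simpa using e.symm) (by simpa using et.symm)
      | cons d t =>
        obtain ⟨rfl, rfl⟩ : c = d ∧ w₂ = t ++ (List.replicate n u).flatten := by simpa using et
        exact ⟨0, n, w₁, t, by omega, e, by simp, rfl⟩

/-- A choice inside one copy leaves `i` copies on its left and `j` on its right. The thresholds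
satisfy `2 ^ (k + 1) - 1 = 2 * (2 ^ k - 1) + 1`, so above the threshold `i` and `j` cannot both be
short: a short side is copied exactly, and otherwise both sides are kept long. -/
theorem flatten_replicate (k : ℕ) (u : List C) {n n' : ℕ}
    (h : n = n' ∨ (2 ^ k - 1 ≤ n ∧ 2 ^ k - 1 ≤ n')) :
    RankEquiv k (List.replicate n u).flatten (List.replicate n' u).flatten := by
  induction k generalizing n n' with
  | zero => trivial
  | succ k ih =>
    refine succ_of_symm (R := fun w w' => ∃ n n', w = (List.replicate n u).flatten ∧
      w' = (List.replicate n' u).flatten ∧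
      (n = n' ∨ (2 ^ (k + 1) - 1 ≤ n ∧ 2 ^ (k + 1) - 1 ≤ n')))
      (fun _ _ ⟨n, n', e, e', h⟩ => ⟨n', n, e', e, by omega⟩) ?_ ⟨n, n', rfl, rfl, h⟩
    rintro w₁ c w₂ _ ⟨n, n', e, rfl, h⟩
    obtain ⟨i, j, u₁, u₂, rfl, hu, rfl, rfl⟩ := exists_of_flatten_replicate_eq e.symm
    have hpow : 2 ^ (k + 1) = 2 * 2 ^ k := by ring
    have hpos : 0 < 2 ^ k := by positivity
    obtain ⟨i', j', hn, hi, hj⟩ : ∃ i' j', n' = i' + j' + 1 ∧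
        (i = i' ∨ (2 ^ k - 1 ≤ i ∧ 2 ^ k - 1 ≤ i')) ∧
        (j = j' ∨ (2 ^ k - 1 ≤ j ∧ 2 ^ k - 1 ≤ j')) := by
      rw [hpow] at h
      generalize 2 ^ k = N at *
      rcases h with rfl | ⟨h, h'⟩
      · exact ⟨i, j, by omega, by omega, by omega⟩
      · by_cases hi : i < N - 1
        · exact ⟨i, n' - 1 - i, by omega, by omega, by omega⟩
        · by_cases hj : j < N - 1
          · exact ⟨n' - 1 - j, j, by omega, by omega, by omega⟩
          · exact ⟨N - 1, n' - 1 - (N - 1), by omega, by omega, by omega⟩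
    refine ⟨(List.replicate i' u).flatten ++ u₁, u₂ ++ (List.replicate j' u).flatten, ?_,
      (ih hi).append (refl _ _), (refl _ _).append (ih hj)⟩
    subst hn
    have : i' + j' + 1 = i' + (1 + j') := by omega
    rw [this, List.replicate_add, List.replicate_add, List.flatten_append, List.flatten_append]
    conv_lhs => rw [List.replicate_one]
    simp [hu]

end RankEquiv

/-! ### Local divisors. -/

/-- The local divisor of a monoid at `c`: the set `cN ∩ Nc`, with the multiplication
`xc ∘ cy = xcy`. -/
def LocalDivisor {N : Type*} [Monoid N] (c : N) : Type _ :=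
  {x : N // (∃ y, x = c * y) ∧ ∃ z, x = z * c}

namespace LocalDivisor

variable {N : Type*} [Monoid N] {c : N}

noncomputable instance : Mul (LocalDivisor c) where
  mul x y := ⟨x.1 * y.2.1.choose, by
    obtain ⟨x, ⟨x', rfl⟩, z, hz⟩ := x
    obtain ⟨y, hy, w, rfl⟩ := y
    refine ⟨⟨x' * hy.choose, by simp [mul_assoc]⟩, z * w, ?_⟩
    simp only
    rw [hz, mul_assoc, ← hy.choose_spec, mul_assoc]⟩

/-- If `y = cy'`, then `zcy' = zy`, so the product does not depend on the chosen `y'`. -/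
theorem mul_val_of_left {x y : LocalDivisor c} {z : N} (hz : x.1 = z * c) :
    (x * y).1 = z * y.1 := by
  change x.1 * y.2.1.choose = _
  rw [hz, mul_assoc, ← y.2.1.choose_spec]

theorem mul_val_of_right {x y : LocalDivisor c} {z : N} (hz : y.1 = c * z) :
    (x * y).1 = x.1 * z := by
  obtain ⟨t, ht⟩ := x.2.2
  rw [mul_val_of_left ht, hz, ht, mul_assoc]

noncomputable instance : Monoid (LocalDivisor c) where
  one := ⟨c, ⟨1, by simp⟩, 1, by simp⟩
  one_mul x := Subtype.ext <| by
    rw [mul_val_of_left (z := 1) (by exact (one_mul c).symm), one_mul]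
  mul_one x := Subtype.ext <| by
    rw [mul_val_of_right (z := 1) (by exact (mul_one c).symm), mul_one]
  mul_assoc x y w := Subtype.ext <| by
    obtain ⟨z, hz⟩ := x.2.2
    obtain ⟨w', hw⟩ := w.2.1
    rw [mul_val_of_right hw, mul_val_of_left hz, mul_val_of_left hz, mul_val_of_right hw,
      mul_assoc]

theorem one_val : (1 : LocalDivisor c).1 = c := rfl

/-- Transfers the stabilization of powers from `N` to the local divisor. -/
theorem pow_val {x : LocalDivisor c} {z : N} (hz : x.1 = c * z) (n : ℕ) :
    (x ^ n).1 = c * z ^ n := by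
  induction n with
  | zero => simp [one_val]
  | succ n ih => rw [pow_succ, mul_val_of_right hz, ih, pow_succ, mul_assoc]

/-- The element `c t c` of the local divisor. -/
def sandwich (c t : N) : LocalDivisor c :=
  ⟨c * t * c, ⟨t * c, mul_assoc _ _ _⟩, c * t, rfl⟩

theorem sandwich_mul_val (t : N) (y : LocalDivisor c) : (sandwich c t * y).1 = c * t * y.1 :=
  mul_val_of_left rfl

instance [Finite N] : Finite (LocalDivisor c) := inferInstanceAs (Finite {_x : N // _})

/-- If `1` were in `cN ∩ Nc`, then `c` would be a unit, and a unit whose powers stabilize is `1`. -/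
theorem card_lt [Finite N] (hN : ∀ x : N, ∃ n : ℕ, x ^ (n + 1) = x ^ n) (hc : c ≠ 1) :
    Nat.card (LocalDivisor c) < Nat.card N := by
  refine Finite.card_subtype_lt (x := (1 : N)) ?_
  rintro ⟨⟨y, hy⟩, z, hz⟩
  have hu : IsUnit c := isUnit_iff_exists.2 ⟨y, hy.symm, by
    rwa [left_inv_eq_right_inv hz.symm hy.symm, eq_comm] at hz⟩
  obtain ⟨n, hn⟩ := hN c
  rw [pow_succ] at hn
  exact hc ((hu.pow n).mul_left_cancel (hn.trans (mul_one _).symm))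

end LocalDivisor

/-! ### Cutting a word at the occurrences of a letter. -/

section Blocks

variable {N : Type*} [Monoid N]

open Classical in
/-- The products of the blocks into which the occurrences of `c` cut a word. -/
noncomputable def blockProds (c : N) : List N → List N
  | [] => [1]
  | x :: w => if x = c then 1 :: blockProds c w else (blockProds c w).modifyHead (x * ·)

theorem blockProds_ne_nil (c : N) (w : List N) : blockProds c w ≠ [] := by
  induction w with
  | nil => simp [blockProds]
  | cons x w ih =>
    rw [blockProds]
    split
    · simp
    · simpa using ih

theorem blockProds_append_cons (c : N) (p q : List N) :
    blockProds c (p ++ c :: q) = blockProds c p ++ blockProds c q := by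
  induction p with
  | nil => simp [blockProds]
  | cons x p ih =>
    obtain ⟨t, ts, h⟩ := List.exists_cons_of_ne_nil (blockProds_ne_nil c p)
    by_cases hx : x = c <;> simp [blockProds, hx, ih, h]

theorem blockProds_of_notMem {c : N} {b : List N} (hb : c ∉ b) : blockProds c b = [b.prod] := by
  induction b with
  | nil => simp [blockProds]
  | cons x b ih =>
    simp only [List.mem_cons, not_or] at hb
    simp [blockProds, Ne.symm hb.1, ih hb.2]

/-- Consecutive sandwiches share one `c` in the local divisor, namely the separator of the two
blocks. -/
theorem sandwich_blockProds (c : N) (w : List N) :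
    ((blockProds c w).map (LocalDivisor.sandwich c)).prod.1 = c * w.prod * c := by
  -- The first block is kept apart without its leading `c`, since it is the block that grows when a
  -- letter is prepended.
  suffices H : ∃ t ts, blockProds c w = t :: ts ∧
      t * (ts.map (LocalDivisor.sandwich c)).prod.1 = w.prod * c by
    obtain ⟨t, ts, h, h'⟩ := H
    rw [h, List.map_cons, List.prod_cons, LocalDivisor.sandwich_mul_val, mul_assoc, h', mul_assoc]
  induction w with
  | nil => exact ⟨1, [], rfl, by simp [LocalDivisor.one_val]⟩
  | cons x w ih =>
    obtain ⟨t, ts, h, h'⟩ := ih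
    by_cases hx : x = c
    · subst hx
      refine ⟨1, t :: ts, by simp [blockProds, h], ?_⟩
      rw [List.map_cons, List.prod_cons, LocalDivisor.sandwich_mul_val, one_mul, mul_assoc, h',
        List.prod_cons, mul_assoc]
    · refine ⟨x * t, ts, by simp [blockProds, h, hx], ?_⟩
      rw [mul_assoc, h', List.prod_cons, mul_assoc]

/-- A block of a word comes from a factor without `c` that is bounded on each side by an
occurrence of `c` or by an end of the word. -/
theorem exists_of_blockProds_eq {c : N} {w X₁ X₂ : List N} {t : N}
    (h : blockProds c w = X₁ ++ t :: X₂) :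
    ∃ p b q, w = p ++ b ++ q ∧ c ∉ b ∧ b.prod = t ∧
      (p = [] ∧ X₁ = [] ∨ ∃ p', p = p' ++ [c] ∧ blockProds c p' = X₁) ∧
      (q = [] ∧ X₂ = [] ∨ ∃ q', q = c :: q' ∧ blockProds c q' = X₂) := by
  induction X₁ generalizing w with
  | nil =>
    by_cases hc : c ∈ w
    · obtain ⟨b, q, rfl, hb⟩ := List.eq_append_cons_of_mem hc
      rw [blockProds_append_cons, blockProds_of_notMem hb] at h
      simp only [List.cons_append, List.nil_append, List.cons.injEq] at h
      exact ⟨[], b, c :: q, by simp, hb, h.1, .inl ⟨rfl, rfl⟩, .inr ⟨q, rfl, h.2⟩⟩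
    · rw [blockProds_of_notMem hc] at h
      simp only [List.nil_append, List.cons.injEq] at h
      exact ⟨[], w, [], by simp, hc, h.1, .inl ⟨rfl, rfl⟩, .inl ⟨rfl, h.2.symm⟩⟩
  | cons x X₁ ih =>
    by_cases hc : c ∈ w
    · obtain ⟨b₀, w, rfl, hb₀⟩ := List.eq_append_cons_of_mem hc
      rw [blockProds_append_cons, blockProds_of_notMem hb₀] at h
      simp only [List.cons_append, List.nil_append, List.cons.injEq] at h
      obtain ⟨h₀, h⟩ := h
      obtain ⟨p, b, q, rfl, hb, ht, hp, hq⟩ := ih h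
      refine ⟨b₀ ++ c :: p, b, q, by simp, hb, ht, .inr ?_, hq⟩
      rcases hp with ⟨rfl, rfl⟩ | ⟨p', rfl, rfl⟩
      · exact ⟨b₀, rfl, by rw [blockProds_of_notMem hb₀, h₀]⟩
      · exact ⟨b₀ ++ c :: p', by simp, by
          rw [blockProds_append_cons, blockProds_of_notMem hb₀, h₀]; rfl⟩
    · rw [blockProds_of_notMem hc] at h
      simp at h

/-- If equivalent words of rank `k` with letters in `P` have equal products, then equivalent words
with letters in `P ∪ {c}` have equivalent words of blocks. -/
theorem RankEquiv.blockProds {c : N} {P : N → Prop} {k : ℕ}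
    (hk : ∀ u v : List N, (∀ x ∈ u, P x) → (∀ x ∈ v, P x) → RankEquiv k u v → u.prod = v.prod)
    (l : ℕ) {u v : List N} (hu : ∀ x ∈ u, x = c ∨ P x) (hv : ∀ x ∈ v, x = c ∨ P x)
    (h : RankEquiv (k + 1 + 2 * l) u v) :
    RankEquiv l (_root_.blockProds c u) (_root_.blockProds c v) := by
  induction l generalizing u v with
  | zero => trivial
  | succ l ih =>
    refine succ_of_symm (R := fun X Y => ∃ u v, X = _root_.blockProds c u ∧
      Y = _root_.blockProds c v ∧ (∀ x ∈ u, x = c ∨ P x) ∧ (∀ x ∈ v, x = c ∨ P x) ∧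
      RankEquiv (k + 1 + 2 * l + 1 + 1) u v)
      (fun _ _ ⟨u, v, e, e', hu, hv, h⟩ => ⟨v, u, e', e, hv, hu, h.symm⟩) ?_
      ⟨u, v, rfl, rfl, hu, hv, h⟩
    rintro X₁ t X₂ _ ⟨u, v, e, rfl, hu, hv, h⟩
    obtain ⟨p, b, q, rfl, hb, rfl, hp, hq⟩ := exists_of_blockProds_eq e.symm
    -- One rank excludes `c` from `b'`; the remaining `k` give equal products.
    have hblock : ∀ b', RankEquiv (k + 1) b b' → (∀ x ∈ b', x ∈ v) →
        c ∉ b' ∧ b.prod = b'.prod := by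
      intro b' hbb hbv
      have hb' : c ∉ b' := fun hc => hb (hbb.symm.mem hc)
      refine ⟨hb', hk _ _ ?_ ?_ hbb.of_succ⟩
      · exact fun x hx => (hu x (by simp [hx])).resolve_left (by rintro rfl; exact hb hx)
      · exact fun x hx => (hv x (hbv x hx)).resolve_left (by rintro rfl; exact hb' hx)
    -- At most two occurrences of `c` bound a block, so at most two moves in the words answer one
    -- move in the words of blocks; hence the term `2 * l`.
    rcases hp with ⟨rfl, rfl⟩ | ⟨p, rfl, rfl⟩
    · rcases hq with ⟨rfl, rfl⟩ | ⟨q, rfl, rfl⟩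
      · obtain ⟨hb', hprod⟩ := hblock v (by simpa using h.mono (by omega)) (fun _ => id)
        exact ⟨[], [], by simp [blockProds_of_notMem hb', hprod], refl _ _, refl _ _⟩
      · obtain ⟨b', q', rfl, h₁, h₂⟩ := h.1 b c q (by simp)
        obtain ⟨hb', hprod⟩ := hblock b' (h₁.mono (by omega)) (by simp +contextual)
        refine ⟨[], _root_.blockProds c q', ?_, refl _ _, ih ?_ ?_ (h₂.mono (by omega))⟩
        · simp [blockProds_append_cons, blockProds_of_notMem hb', hprod]
        · exact fun x hx => hu x (by simp [hx])
        · exact fun x hx => hv x (by simp [hx])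
    · obtain ⟨p', w, rfl, h₁, h₂⟩ := h.1 p c (b ++ q) (by simp)
      have hpp : RankEquiv l (_root_.blockProds c p) (_root_.blockProds c p') :=
        ih (fun x hx => hu x (by simp [hx])) (fun x hx => hv x (by simp [hx]))
          (h₁.mono (by omega))
      rcases hq with ⟨rfl, rfl⟩ | ⟨q, rfl, rfl⟩
      · obtain ⟨hb', hprod⟩ := hblock w (by simpa using h₂.mono (by omega)) (by simp +contextual)
        refine ⟨_root_.blockProds c p', [], ?_, hpp, refl _ _⟩
        simp [blockProds_append_cons, blockProds_of_notMem hb', hprod]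
      · obtain ⟨b', q', rfl, h₃, h₄⟩ :=
          (h₂.mono (by omega : k + 1 + 2 * l + 1 ≤ _)).1 b c q rfl
        obtain ⟨hb', hprod⟩ := hblock b' (h₃.mono (by omega)) (by simp +contextual)
        refine ⟨_root_.blockProds c p', _root_.blockProds c q', ?_, hpp,
          ih ?_ ?_ (h₄.mono (by omega))⟩
        · simp [blockProds_append_cons, blockProds_of_notMem hb', hprod]
        · exact fun x hx => hu x (by simp [hx])
        · exact fun x hx => hv x (by simp [hx])

end Blocks

/-! ### Schützenberger's theorem. -/

/-- **Schützenberger's theorem**, in terms of Ehrenfeucht–Fraïssé equivalence: in a finite aperiodic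
monoid the product of a word depends only on its equivalence class of some rank. -/
theorem exists_prod_eq_of_rankEquiv {N : Type*} [Monoid N] [Finite N]
    (hN : ∀ x : N, ∃ n : ℕ, x ^ (n + 1) = x ^ n) :
    ∃ k, ∀ u v : List N, RankEquiv k u v → u.prod = v.prod := by
  classical
  induction hn : Nat.card N using Nat.strong_induction_on generalizing N with
  | _ n IH =>
  subst hn
  -- An inner induction on the allowed letters. The letter `1` is always allowed, so each letter
  -- that matters is `c ≠ 1`, as `LocalDivisor.card_lt` requires.
  suffices H : ∀ D : Finset N, ∃ k, ∀ u v : List N, (∀ x ∈ u, x = 1 ∨ x ∈ D) →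
      (∀ x ∈ v, x = 1 ∨ x ∈ D) → RankEquiv k u v → u.prod = v.prod by
    have := Fintype.ofFinite N
    obtain ⟨k, hk⟩ := H Finset.univ
    exact ⟨k, fun u v => hk u v (by simp) (by simp)⟩
  intro D
  induction D using Finset.induction_on with
  | empty =>
    refine ⟨0, fun u v hu hv _ => ?_⟩
    rw [List.prod_eq_one (by simpa using hu), List.prod_eq_one (by simpa using hv)]
  | insert c D _ ih =>
    obtain ⟨k, hk⟩ := ih
    by_cases hc : c = 1
    · exact ⟨k, fun u v hu hv => hk u v (by simpa [hc] using hu) (by simpa [hc] using hv)⟩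
    obtain ⟨l, hl⟩ := IH _ (LocalDivisor.card_lt hN hc) (N := LocalDivisor c) (fun x => by
      obtain ⟨z, hz⟩ := x.2.1
      obtain ⟨n, hn⟩ := hN z
      exact ⟨n, Subtype.ext <| by
        rw [LocalDivisor.pow_val hz, LocalDivisor.pow_val hz, hn]⟩) rfl
    -- Two moves cut at the first and the last `c` of `u`; the rest is the rank that
    -- `RankEquiv.blockProds` needs for the middle factor.
    refine ⟨k + 1 + 2 * l + 2, fun u v hu hv h => ?_⟩
    have hu : ∀ x ∈ u, x = c ∨ x = 1 ∨ x ∈ D := fun x hx => by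
      simpa [or_left_comm] using hu x hx
    have hv : ∀ x ∈ v, x = c ∨ x = 1 ∨ x ∈ D := fun x hx => by
      simpa [or_left_comm] using hv x hx
    have free : ∀ b b' : List N, (∀ x ∈ b, x ∈ u) → (∀ x ∈ b', x ∈ v) → RankEquiv (k + 1) b b' →
        c ∉ b → b.prod = b'.prod := by
      intro b b' hbu hbv hbb hb
      have hb' : c ∉ b' := fun hc => hb (hbb.symm.mem hc)
      refine hk _ _ ?_ ?_ hbb.of_succ
      · exact fun x hx => (hu x (hbu x hx)).resolve_left (by rintro rfl; exact hb hx)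
      · exact fun x hx => (hv x (hbv x hx)).resolve_left (by rintro rfl; exact hb' hx)
    by_cases hcu : c ∈ u
    · obtain ⟨u₀, u₁, rfl, hu₀⟩ := List.eq_append_cons_of_mem hcu
      obtain ⟨v₀, v₁, rfl, h₀, h₁⟩ := h.1 _ _ _ rfl
      rw [List.prod_append, List.prod_append, List.prod_cons, List.prod_cons,
        free u₀ v₀ (by simp +contextual) (by simp +contextual) (h₀.mono (by omega)) hu₀]
      congr 1
      by_cases hcu₁ : c ∈ u₁
      -- The last `c` is the first one of the reversed word.
      · obtain ⟨r, s, hrs, hr⟩ := List.eq_append_cons_of_mem (List.mem_reverse.2 hcu₁)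
        obtain rfl : u₁ = s.reverse ++ c :: r.reverse := by
          rw [← List.reverse_reverse u₁, hrs]; simp
        obtain ⟨v₂, v₃, rfl, h₂, h₃⟩ := h₁.1 _ _ _ rfl
        have hlast := free r.reverse v₃ (by simp +contextual) (by simp +contextual)
          (h₃.mono (by omega)) (by simpa using hr)
        have hmid := congrArg Subtype.val (hl _ _ ((RankEquiv.blockProds (c := c) hk l
          (fun x hx => hu x (by simp at hx; simp [hx])) (fun x hx => hv x (by simp [hx]))
          h₂).map (LocalDivisor.sandwich c)))
        rw [sandwich_blockProds, sandwich_blockProds] at hmid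
        simp only [List.prod_append, List.prod_cons, hlast, ← mul_assoc]
        rw [hmid]
      · rw [free u₁ v₁ (by simp +contextual) (by simp +contextual) (h₁.mono (by omega)) hcu₁]
    · exact free u v (fun _ => id) (fun _ => id) (h.mono (by omega)) hcu

open FirstOrder

/-! ### Labelling by residues. -/

section Labels

variable {A : Type*}

/-- The word obtained from `w` by pairing every letter with its position modulo `m`, where the
positions are numbered from `r`. -/
def labelFrom {m : ℕ} (r : ZMod m) : List A → List (A × ZMod m)
  | [] => []
  | a :: w => (a, r) :: labelFrom (r + 1) w

theorem labelFrom_append {m : ℕ} (r : ZMod m) (u v : List A) :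
    labelFrom r (u ++ v) = labelFrom r u ++ labelFrom (r + (u.length : ZMod m)) v := by
  induction u generalizing r with
  | nil => simp [labelFrom]
  | cons a u ih => simp [labelFrom, ih, add_assoc, add_comm (1 : ZMod m)]

@[simp]
theorem length_labelFrom {m : ℕ} (r : ZMod m) (w : List A) :
    (labelFrom r w).length = w.length := by
  induction w generalizing r with
  | nil => rfl
  | cons a w ih => simp [labelFrom, ih]

@[simp]
theorem getElem_labelFrom {m : ℕ} (r : ZMod m) (w : List A) (i : ℕ)
    (hi : i < (labelFrom r w).length) :
    (labelFrom r w)[i] = (w[i]'(by simpa using hi), r + (i : ZMod m)) := by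
  induction w generalizing r i with
  | nil => simp [labelFrom] at hi
  | cons a w ih =>
    cases i with
    | zero => simp [labelFrom]
    | succ i => simp [labelFrom, ih, add_assoc, add_comm (1 : ZMod m)]

/-- Every copy starts at the same residue. This is why necessity yields aperiodicity only for
lengths divisible by `m`. -/
theorem labelFrom_flatten_replicate {m : ℕ} (r : ZMod m) {w : List A}
    (hw : (w.length : ZMod m) = 0) (n : ℕ) :
    labelFrom r (List.replicate n w).flatten = (List.replicate n (labelFrom r w)).flatten := by
  induction n with
  | zero => rfl
  | succ n ih => simp [List.replicate_succ, labelFrom_append, ih, hw]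

end Labels

/-! ### Encoding assignments of variables in words. -/

section Marks

variable {A : Type*}

/-- The word `w` in which every letter is paired with its position modulo `m` and with the set of
the variables that are assigned to its position. -/
def markedWord (m : ℕ) {n : ℕ} (w : List A) (x : Fin n → Fin w.length) :
    List ((A × ZMod m) × Set (Fin n)) :=
  (labelFrom (0 : ZMod m) w).mapIdx fun i c => (c, {j | (x j : ℕ) = i})

/-- Adds the variable `n` to a set of variables when `b` holds. -/
def extendMark {m n : ℕ} (b : Prop) (c : (A × ZMod m) × Set (Fin n)) :
    (A × ZMod m) × Set (Fin (n + 1)) :=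
  (c.1, {j | Fin.lastCases (motive := fun _ => Prop) b (fun j => j ∈ c.2) j})

@[simp]
theorem length_markedWord (m : ℕ) {n : ℕ} (w : List A) (x : Fin n → Fin w.length) :
    (markedWord m w x).length = w.length := by
  simp [markedWord]

/-- For the quantifier step: on each side of `p` the new variable changes the marks letter by
letter, so `RankEquiv.map` applies to both factors. -/
theorem markedWord_snoc {m n : ℕ} {w : List A} {x : Fin n → Fin w.length} {p : Fin w.length}
    {u₁ u₂ : List ((A × ZMod m) × Set (Fin n))} {c : (A × ZMod m) × Set (Fin n)}
    (h : markedWord m w x = u₁ ++ c :: u₂) (hp : (p : ℕ) = u₁.length) :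
    markedWord m w (Fin.snoc (α := fun _ => Fin w.length) x p) =
      u₁.map (extendMark False) ++ extendMark True c :: u₂.map (extendMark False) := by
  have key : markedWord m w (Fin.snoc (α := fun _ => Fin w.length) x p) =
      (markedWord m w x).mapIdx fun i c => extendMark ((p : ℕ) = i) c := by
    rw [markedWord, markedWord, List.mapIdx_mapIdx]
    congr 1
    funext i c
    refine Prod.ext rfl (Set.ext fun j => ?_)
    refine Fin.lastCases ?_ (fun j => ?_) j <;> simp [extendMark]
  rw [key, h, List.mapIdx_append, List.mapIdx_cons, hp]
  congr 1
  · refine List.ext_getElem (by simp) fun i hi hi' => ?_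
    have : u₁.length ≠ i := by simp at hi; omega
    simp [this]
  · congr 1
    · simp
    · refine List.ext_getElem (by simp) fun i hi hi' => ?_
      simp

theorem getElem_markedWord {m n : ℕ} {w : List A} {x : Fin n → Fin w.length} {i : ℕ}
    (hi : i < (markedWord m w x).length) :
    (markedWord m w x)[i] = ((w[i]'(by simpa using hi), (i : ZMod m)), {j | (x j : ℕ) = i}) := by
  simp [markedWord]

/-- The letter of the marked word at the position of the variable `j`. -/
theorem exists_markedWord_eq {m n : ℕ} (w : List A) (x : Fin n → Fin w.length) (j : Fin n) :
    ∃ u₁ u₂, markedWord m w x =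
      u₁ ++ ((w.get (x j), ((x j : ℕ) : ZMod m)), {i | (x i : ℕ) = x j}) :: u₂ ∧
      u₁.length = x j := by
  have hj : (x j : ℕ) < (markedWord m w x).length := by simp
  refine ⟨(markedWord m w x).take (x j), (markedWord m w x).drop (x j + 1), ?_, by simp⟩
  conv_lhs => rw [← List.take_append_drop (x j) (markedWord m w x),
    List.drop_eq_getElem_cons hj, getElem_markedWord hj]
  rfl

theorem eq_of_markedWord_eq {m n : ℕ} {w : List A} {x : Fin n → Fin w.length}
    {u₁ u₂ : List ((A × ZMod m) × Set (Fin n))} {c : (A × ZMod m) × Set (Fin n)}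
    (h : markedWord m w x = u₁ ++ c :: u₂) :
    ∃ hp : u₁.length < w.length,
      c = ((w[u₁.length], (u₁.length : ZMod m)), {j | (x j : ℕ) = u₁.length}) := by
  have hl := congrArg List.length h
  simp at hl
  have hp : u₁.length < (markedWord m w x).length := by simp; omega
  refine ⟨by simpa using hp, ?_⟩
  rw [← getElem_markedWord hp]
  simp [h]

/-- Equivalent marked words carry the variable `j` at positions with the same letter, the same
residue and the same variables; the factors around these positions are equivalent. -/
theorem RankEquiv.markedWord_split {m n k : ℕ} {w w' : List A} {x : Fin n → Fin w.length}
    {x' : Fin n → Fin w'.length} (h : RankEquiv (k + 1) (markedWord m w x) (markedWord m w' x'))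
    (j : Fin n) :
    ((w.get (x j), ((x j : ℕ) : ZMod m)), {i | (x i : ℕ) = x j}) =
      ((w'.get (x' j), ((x' j : ℕ) : ZMod m)), {i | (x' i : ℕ) = x' j}) ∧
    RankEquiv k ((markedWord m w x).take (x j)) ((markedWord m w' x').take (x' j)) := by
  obtain ⟨u₁, u₂, e, hu⟩ := exists_markedWord_eq (m := m) w x j
  obtain ⟨v₁, v₂, e', h₁, h₂⟩ := h.1 _ _ _ e
  obtain ⟨hp, hc⟩ := eq_of_markedWord_eq e'
  have hj : (x' j : ℕ) = v₁.length :=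
    (Set.ext_iff.1 (Prod.ext_iff.1 hc).2 j).1 rfl
  refine ⟨hc.trans ?_, ?_⟩
  · simp only [← hj, List.get_eq_getElem]
  · rw [e, e', ← hu, hj]
    simpa using h₁

/-- Turns the order of two variables into the occurrence of a mark, which equivalence of rank 1
preserves. -/
theorem mem_take_markedWord {m n : ℕ} {w : List A} {x : Fin n → Fin w.length} {i j : Fin n} :
    (∃ c ∈ (markedWord m w x).take (x j), i ∈ c.2) ↔ x i < x j := by
  constructor
  · rintro ⟨c, hc, hi⟩
    obtain ⟨p, hp, rfl⟩ := List.mem_iff_getElem.1 hc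
    rw [List.getElem_take, getElem_markedWord] at hi
    have : (x i : ℕ) = p := hi
    simp at hp
    omega
  · intro h
    refine ⟨(markedWord m w x)[(x i : ℕ)]'(by simp), ?_, ?_⟩
    · rw [List.mem_iff_getElem]
      exact ⟨x i, by simpa using h, by simp⟩
    · rw [getElem_markedWord]
      rfl

end Marks

/-! ### Formulas respect the equivalence of marked words. -/

section Formulas

variable {A : Type*}

theorem exists_term_eq_var {n : ℕ} (t : (wordSignature A).Term (Empty ⊕ Fin n)) :
    ∃ j : Fin n, t = Language.Term.var (Sum.inr j) := by
  cases t with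
  | var v =>
    cases v with
    | inl e => exact e.elim
    | inr j => exact ⟨j, rfl⟩
  | func f _ => exact Empty.elim f

/-- The truth value of a formula in a word, the relation `≡` being congruence modulo `m`. -/
def FormulaHolds (m : ℕ) {n : ℕ} (φ : (wordSignature A).BoundedFormula Empty n) (w : List A)
    (x : Fin n → Fin w.length) : Prop :=
  @Language.BoundedFormula.Realize _ _ (wordStructure m w) _ _ φ Empty.elim x

theorem wordSatisfies_iff (m : ℕ) (w : List A) (φ : (wordSignature A).Sentence) :
    WordSatisfies m w φ ↔ FormulaHolds m φ w Fin.elim0 := by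
  change @Language.BoundedFormula.Realize _ _ (wordStructure m w) _ _ φ default default ↔
    @Language.BoundedFormula.Realize _ _ (wordStructure m w) _ _ φ Empty.elim Fin.elim0
  rw [Subsingleton.elim (default : Empty → Fin w.length) Empty.elim,
    Subsingleton.elim (default : Fin 0 → Fin w.length) Fin.elim0]

/-- The truth value of a formula in a word depends only on the equivalence class of some rank of the
marked word. -/
theorem exists_formulaHolds_iff (m : ℕ) {n : ℕ}
    (φ : (wordSignature A).BoundedFormula Empty n) :
    ∃ k, ∀ (w w' : List A) (x : Fin n → Fin w.length) (x' : Fin n → Fin w'.length),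
      RankEquiv k (markedWord m w x) (markedWord m w' x') →
        (FormulaHolds m φ w x ↔ FormulaHolds m φ w' x') := by
  induction φ with
  | falsum => exact ⟨0, fun _ _ _ _ _ => Iff.rfl⟩
  | equal t₁ t₂ =>
    obtain ⟨i, rfl⟩ := exists_term_eq_var t₁
    obtain ⟨j, rfl⟩ := exists_term_eq_var t₂
    refine ⟨1, fun w w' x x' h => ?_⟩
    have h' := Set.ext_iff.1 (Prod.ext_iff.1 (h.markedWord_split j).1).2 i
    change x i = x j ↔ x' i = x' j
    simpa [Fin.ext_iff] using h'
  | rel R ts =>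
    choose v hv using fun i => exists_term_eq_var (ts i)
    obtain rfl : ts = fun i => Language.Term.var (Sum.inr (v i)) := funext hv
    -- One move reaches a variable; `<` needs one more, to look for a mark in the left factor.
    refine ⟨2, fun w w' x x' h => ?_⟩
    cases R with
    | letter a =>
      have h' := (Prod.ext_iff.1 (Prod.ext_iff.1 (h.markedWord_split (v 0)).1).1).1
      change w.get (x (v 0)) = a ↔ w'.get (x' (v 0)) = a
      rw [show w.get (x (v 0)) = w'.get (x' (v 0)) from h']
    | lt =>
      change x (v 0) < x (v 1) ↔ x' (v 0) < x' (v 1)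
      rw [← mem_take_markedWord (m := m), ← mem_take_markedWord (m := m)]
      have h' := (h.markedWord_split (v 1)).2
      exact exists_congr fun c => and_congr_left fun _ => h'.mem_iff
    | modEq =>
      change (x (v 0) : ℕ) ≡ x (v 1) [MOD m] ↔ (x' (v 0) : ℕ) ≡ x' (v 1) [MOD m]
      have h₀ := (Prod.ext_iff.1 (Prod.ext_iff.1 (h.markedWord_split (v 0)).1).1).2
      have h₁ := (Prod.ext_iff.1 (Prod.ext_iff.1 (h.markedWord_split (v 1)).1).1).2
      simp only at h₀ h₁
      rw [← ZMod.natCast_eq_natCast_iff, ← ZMod.natCast_eq_natCast_iff, h₀, h₁]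
  | imp φ ψ ih₁ ih₂ =>
    obtain ⟨k, hk⟩ := ih₁
    obtain ⟨l, hl⟩ := ih₂
    refine ⟨max k l, fun w w' x x' h => ?_⟩
    exact imp_congr (hk _ _ _ _ (h.mono (le_max_left _ _))) (hl _ _ _ _ (h.mono (le_max_right _ _)))
  | @all n φ ih =>
    obtain ⟨k, hk⟩ := ih
    refine ⟨k + 1, fun w w' x x' h => ?_⟩
    suffices H : ∀ (w w' : List A) (x : Fin n → Fin w.length) (x' : Fin n → Fin w'.length),
        RankEquiv (k + 1) (markedWord m w x) (markedWord m w' x') →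
        FormulaHolds m φ.all w' x' → FormulaHolds m φ.all w x from
      ⟨H _ _ _ _ h.symm, H _ _ _ _ h⟩
    intro w w' x x' h hφ p
    have hp : (p : ℕ) < (markedWord m w x).length := by simp
    have e : markedWord m w x = (markedWord m w x).take p ++
        (markedWord m w x)[(p : ℕ)] :: (markedWord m w x).drop (p + 1) := by
      rw [← List.drop_eq_getElem_cons, List.take_append_drop]
    obtain ⟨v₁, v₂, e', h₁, h₂⟩ := h.1 _ _ _ e
    obtain ⟨hp', -⟩ := eq_of_markedWord_eq e'
    refine (hk w w' _ (Fin.snoc (α := fun _ => Fin w'.length) x' ⟨v₁.length, hp'⟩) ?_).2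
      (hφ ⟨v₁.length, hp'⟩)
    rw [markedWord_snoc e (by simp), markedWord_snoc e' rfl]
    exact (h₁.map _).append (RankEquiv.append (u := [_]) (u' := [_]) (.refl _ _) (h₂.map _))

/-- The satisfaction of a sentence by a word depends only on the equivalence class of some rank of
the word labelled with residues. -/
theorem exists_wordSatisfies_iff (m : ℕ) (φ : (wordSignature A).Sentence) :
    ∃ k, ∀ w w' : List A, RankEquiv k (labelFrom (0 : ZMod m) w) (labelFrom (0 : ZMod m) w') →
      (WordSatisfies m w φ ↔ WordSatisfies m w' φ) := by
  obtain ⟨k, hk⟩ := exists_formulaHolds_iff m φ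
  refine ⟨k, fun w w' h => ?_⟩
  have key : ∀ w : List A, markedWord m w (Fin.elim0 : Fin 0 → Fin w.length) =
      (labelFrom (0 : ZMod m) w).map fun c => (c, (∅ : Set (Fin 0))) := by
    intro w
    refine List.ext_getElem (by simp) fun i hi hi' => ?_
    simp [markedWord, Set.eq_empty_of_isEmpty]
  rw [wordSatisfies_iff, wordSatisfies_iff]
  exact hk _ _ _ _ (by rw [key, key]; exact h.map _)

end Formulas

/-! ### Definability of the equivalence classes. -/

section Definable

variable {A : Type*}

/-- A relation between the positions of words is definable when some formula holds exactly for the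
tuples of positions in the relation. -/
def WordDefinable (m n : ℕ) (R : (w : List A) → (Fin n → Fin w.length) → Prop) : Prop :=
  ∃ φ : (wordSignature A).BoundedFormula Empty n, ∀ w x, R w x ↔ FormulaHolds m φ w x

namespace WordDefinable

variable {m n : ℕ} {R R' : (w : List A) → (Fin n → Fin w.length) → Prop}

theorem congr (h : WordDefinable m n R) (e : ∀ w x, R' w x ↔ R w x) : WordDefinable m n R' :=
  h.imp fun _ hφ w x => (e w x).trans (hφ w x)

protected theorem true : WordDefinable m n fun (_ : List A) _ => True :=
  ⟨⊤, fun w x => by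
    let _ := wordStructure m w
    exact Language.BoundedFormula.realize_top.symm⟩

protected theorem not (h : WordDefinable m n R) : WordDefinable m n fun w x => ¬ R w x := by
  obtain ⟨φ, hφ⟩ := h
  exact ⟨φ.not, fun w x => not_congr (hφ w x)⟩

theorem imp (h : WordDefinable m n R) (h' : WordDefinable m n R') :
    WordDefinable m n fun w x => R w x → R' w x := by
  obtain ⟨φ, hφ⟩ := h
  obtain ⟨ψ, hψ⟩ := h'
  exact ⟨φ.imp ψ, fun w x => imp_congr (hφ w x) (hψ w x)⟩

theorem and (h : WordDefinable m n R) (h' : WordDefinable m n R') :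
    WordDefinable m n fun w x => R w x ∧ R' w x :=
  (h.imp h'.not).not.congr fun w x => by tauto

theorem all {R : (w : List A) → (Fin (n + 1) → Fin w.length) → Prop}
    (h : WordDefinable m (n + 1) R) :
    WordDefinable m n fun w x => ∀ p, R w (Fin.snoc (α := fun _ => Fin w.length) x p) := by
  obtain ⟨φ, hφ⟩ := h
  refine ⟨φ.all, fun w x => ?_⟩
  simp only [hφ]
  rfl

theorem ex {R : (w : List A) → (Fin (n + 1) → Fin w.length) → Prop}
    (h : WordDefinable m (n + 1) R) :
    WordDefinable m n fun w x => ∃ p, R w (Fin.snoc (α := fun _ => Fin w.length) x p) :=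
  h.not.all.not.congr fun w x => by simp

theorem forall_finite {ι : Type*} [Finite ι]
    {R : ι → (w : List A) → (Fin n → Fin w.length) → Prop} (h : ∀ i, WordDefinable m n (R i)) :
    WordDefinable m n fun w x => ∀ i, R i w x := by
  choose φ hφ using h
  refine ⟨Language.BoundedFormula.iInf φ, fun w x => ?_⟩
  let _ := wordStructure m w
  exact (forall_congr' fun i => hφ i w x).trans Language.BoundedFormula.realize_iInf.symm

theorem exists_finite {ι : Type*} [Finite ι]
    {R : ι → (w : List A) → (Fin n → Fin w.length) → Prop} (h : ∀ i, WordDefinable m n (R i)) :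
    WordDefinable m n fun w x => ∃ i, R i w x :=
  (forall_finite fun i => (h i).not).not.congr fun w x => by simp

theorem letter (a : A) (j : Fin n) : WordDefinable m n fun w x => w.get (x j) = a :=
  ⟨.rel (WordRel.letter a : (wordSignature A).Relations 1) fun _ => .var (.inr j),
    fun _ _ => Iff.rfl⟩

theorem lt (i j : Fin n) : WordDefinable m n fun (_ : List A) x => x i < x j :=
  ⟨.rel (WordRel.lt : (wordSignature A).Relations 2) fun l => .var (.inr (![i, j] l)),
    fun _ _ => Iff.rfl⟩

theorem modEq (i j : Fin n) :
    WordDefinable m n fun (_ : List A) x => (x i : ℕ) ≡ x j [MOD m] :=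
  ⟨.rel (WordRel.modEq : (wordSignature A).Relations 2) fun l => .var (.inr (![i, j] l)),
    fun _ _ => Iff.rfl⟩

theorem le_position (t : ℕ) (j : Fin n) :
    WordDefinable m n fun (_ : List A) x => t ≤ (x j : ℕ) := by
  induction t generalizing n with
  | zero => exact WordDefinable.true.congr fun w x => by simp
  | succ t ih =>
    refine ((ih (Fin.last n)).and (lt (Fin.last n) j.castSucc)).ex.congr fun w x => ?_
    simp only [Fin.snoc_last, Fin.snoc_castSucc]
    constructor
    · intro h
      exact ⟨⟨t, by omega⟩, le_rfl, Fin.lt_def.2 (by simpa using h)⟩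
    · rintro ⟨p, hp, h⟩
      have := Fin.lt_def.1 h
      omega

theorem position_eq (t : ℕ) (j : Fin n) :
    WordDefinable m n fun (_ : List A) x => (x j : ℕ) = t :=
  ((le_position t j).and (le_position (t + 1) j).not).congr fun w x => by omega

/-- Only congruence of two positions is expressible, so position `r.val` serves as reference. It
exists whenever some position has residue `r`, because `x % m ≤ x`. -/
theorem residue_eq [NeZero m] (r : ZMod m) (j : Fin n) :
    WordDefinable m n fun (_ : List A) x => ((x j : ℕ) : ZMod m) = r := by
  refine ((position_eq r.val (Fin.last n)).and (modEq j.castSucc (Fin.last n))).ex.congr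
    fun w x => ?_
  simp only [Fin.snoc_last, Fin.snoc_castSucc]
  constructor
  · rintro rfl
    have h := Nat.mod_le (x j : ℕ) m
    refine ⟨⟨(x j : ℕ) % m, by omega⟩, (ZMod.val_natCast _ _).symm, ?_⟩
    exact (Nat.mod_modEq _ _).symm
  · rintro ⟨p, hp, h⟩
    rw [(ZMod.natCast_eq_natCast_iff _ _ _).2 h, hp, ZMod.natCast_zmod_val]

end WordDefinable

/-- The first position to the right of `lo`, the beginning of the word when `lo` is `none`. -/
def lowerEnd {n : ℕ} (w : List A) (x : Fin n → Fin w.length) (lo : Option (Fin n)) : ℕ :=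
  lo.elim 0 fun j => x j + 1

/-- The position `hi`, the end of the word when `hi` is `none`. -/
def upperEnd {n : ℕ} (w : List A) (x : Fin n → Fin w.length) (hi : Option (Fin n)) : ℕ :=
  hi.elim w.length fun j => x j

/-- The factor of a word between the positions `a` (included) and `b` (excluded). -/
def List.segment {C : Type*} (l : List C) (a b : ℕ) : List C := (l.take b).drop a

theorem List.segment_eq_append_cons {C : Type*} {l : List C} {a b p : ℕ} (hap : a ≤ p)
    (hpb : p < b) (hp : p < l.length) :
    l.segment a b = l.segment a p ++ l[p] :: l.segment (p + 1) b := by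
  have h₁ : l.take b = l.take p ++ l[p] :: (l.take b).drop (p + 1) := by
    have hp' : p < (l.take b).length := by simp; omega
    conv_lhs => rw [← List.take_append_drop p (l.take b), List.drop_eq_getElem_cons hp',
      List.take_take, min_eq_left hpb.le, List.getElem_take]
  rw [List.segment, h₁, List.drop_append_of_le_length (by simp; omega)]
  rfl

theorem List.exists_of_segment_eq {C : Type*} {l : List C} {a b : ℕ} {v₁ v₂ : List C} {c : C}
    (h : l.segment a b = v₁ ++ c :: v₂) :
    ∃ p, ∃ hp : p < l.length, a ≤ p ∧ p < b ∧ v₁ = l.segment a p ∧ c = l[p] ∧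
      v₂ = l.segment (p + 1) b := by
  have hl := congrArg List.length h
  simp [List.segment] at hl
  have hp : a + v₁.length < l.length := by omega
  have hpb : a + v₁.length < b := by omega
  refine ⟨a + v₁.length, hp, by omega, hpb, ?_⟩
  rw [List.segment_eq_append_cons (by omega) hpb hp] at h
  have := List.append_inj h (by simp [List.segment]; omega)
  simp only [List.cons.injEq] at this
  exact ⟨this.1.symm, this.2.1.symm, this.2.2.symm⟩

/-- Prepares the translation into logic: positions of `l` become first-order variables, those of the
fixed word `u` index finite conjunctions and disjunctions, and the two factors are again segments.
-/
theorem rankEquiv_succ_segment_iff {C : Type*} {k : ℕ} {u l : List C} {a b : ℕ} :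
    RankEquiv (k + 1) u (l.segment a b) ↔
      (∀ i : Fin u.length, ∃ p : Fin l.length, (a ≤ p ∧ p < b) ∧ l.get p = u.get i ∧
        RankEquiv k (u.take i) (l.segment a p) ∧
        RankEquiv k (u.drop (i + 1)) (l.segment (p + 1) b)) ∧
      (∀ p : Fin l.length, (a ≤ p ∧ p < b) → ∃ i : Fin u.length, l.get p = u.get i ∧
        RankEquiv k (u.take i) (l.segment a p) ∧
        RankEquiv k (u.drop (i + 1)) (l.segment (p + 1) b)) := by
  have hu : ∀ i : Fin u.length, u = u.take i ++ u.get i :: u.drop (i + 1) := fun i => by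
    rw [List.get_eq_getElem, ← List.drop_eq_getElem_cons, List.take_append_drop]
  constructor
  · refine fun h => ⟨fun i => ?_, fun p hp => ?_⟩
    · obtain ⟨v₁, v₂, e, h₁, h₂⟩ := h.1 _ _ _ (hu i)
      obtain ⟨p, hp, hap, hpb, rfl, hc, rfl⟩ := List.exists_of_segment_eq e
      exact ⟨⟨p, hp⟩, ⟨hap, hpb⟩, hc.symm, h₁, h₂⟩
    · obtain ⟨u₁, u₂, rfl, h₁, h₂⟩ := h.2 _ _ _ (List.segment_eq_append_cons hp.1 hp.2 p.2)
      exact ⟨⟨u₁.length, by simp⟩, by simp, by simpa using h₁.symm, by simpa using h₂.symm⟩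
  · rintro ⟨h, h'⟩
    refine ⟨fun u₁ c u₂ e => ?_, fun v₁ c v₂ e => ?_⟩
    · subst e
      obtain ⟨p, hp, hc, h₁, h₂⟩ := h ⟨u₁.length, by simp⟩
      have e := List.segment_eq_append_cons hp.1 hp.2 p.2
      rw [show l[(p : ℕ)] = _ from hc] at e
      exact ⟨_, _, by simpa using e, by simpa using h₁, by simpa using h₂⟩
    · obtain ⟨p, hp, hap, hpb, rfl, rfl, rfl⟩ := List.exists_of_segment_eq e
      obtain ⟨i, hc, h₁, h₂⟩ := h' ⟨p, hp⟩ ⟨hap, hpb⟩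
      refine ⟨_, _, ?_, h₁.symm, h₂.symm⟩
      conv_lhs => rw [hu i, ← hc]
      rfl

/-- The words that are equivalent to a given one are definable, also for factors of a word. -/
theorem WordDefinable.rankEquiv_segment {m : ℕ} [NeZero m] (k : ℕ) (u : List (A × ZMod m)) {n : ℕ}
    (lo hi : Option (Fin n)) :
    WordDefinable m n fun (w : List A) x =>
      RankEquiv k u ((labelFrom (0 : ZMod m) w).segment (lowerEnd w x lo) (upperEnd w x hi)) := by
  induction k generalizing u n with
  | zero => exact WordDefinable.true
  | succ k ih =>
    have between : WordDefinable m (n + 1) fun (w : List A) x =>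
        lowerEnd w x (lo.map Fin.castSucc) ≤ x (Fin.last n) ∧
          x (Fin.last n) < upperEnd w x (hi.map Fin.castSucc) := by
      refine .and ?_ ?_
      · cases lo with
        | none => exact WordDefinable.true.congr fun w x => by simp [lowerEnd]
        | some j => exact (WordDefinable.lt j.castSucc (Fin.last n)).congr fun w x => Iff.rfl
      · cases hi with
        | none => exact WordDefinable.true.congr fun w x => by simp [upperEnd]
        | some j => exact (WordDefinable.lt (Fin.last n) j.castSucc).congr fun w x => Iff.rfl
    have split : ∀ i : Fin u.length, WordDefinable m (n + 1) fun (w : List A) x =>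
        (w.get (x (Fin.last n)) = (u.get i).1 ∧ ((x (Fin.last n) : ℕ) : ZMod m) = (u.get i).2) ∧
        RankEquiv k (u.take i) ((labelFrom (0 : ZMod m) w).segment
          (lowerEnd w x (lo.map Fin.castSucc)) (upperEnd w x (some (Fin.last n)))) ∧
        RankEquiv k (u.drop (i + 1)) ((labelFrom (0 : ZMod m) w).segment
          (lowerEnd w x (some (Fin.last n))) (upperEnd w x (hi.map Fin.castSucc))) :=
      fun i => ((WordDefinable.letter _ _).and (WordDefinable.residue_eq _ _)).and
        ((ih _ _ _).and (ih _ _ _))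
    refine ((WordDefinable.forall_finite fun i => (between.and (split i)).ex).and
      (between.imp (WordDefinable.exists_finite split)).all).congr fun w x => ?_
    have hlo : ∀ p, lowerEnd w (Fin.snoc (α := fun _ => Fin w.length) x p)
        (lo.map Fin.castSucc) = lowerEnd w x lo := fun p => by
      cases lo <;> simp [lowerEnd]
    have hhi : ∀ p, upperEnd w (Fin.snoc (α := fun _ => Fin w.length) x p)
        (hi.map Fin.castSucc) = upperEnd w x hi := fun p => by
      cases hi <;> simp [upperEnd]
    let e : Fin (labelFrom (0 : ZMod m) w).length ≃ Fin w.length := finCongr (by simp)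
    rw [rankEquiv_succ_segment_iff]
    simp only [hlo, hhi, Fin.snoc_last]
    refine and_congr (forall_congr' fun i => ?_) ?_
    · refine e.exists_congr fun p => ?_
      simp [e, lowerEnd, upperEnd, Prod.ext_iff]
    · refine e.forall_congr fun p => ?_
      simp [e, lowerEnd, upperEnd, Prod.ext_iff]

/-- A language whose membership depends on the equivalence class of some rank of the labelled word
is definable. -/
theorem mem_FOLtMod_of_rankEquiv [Finite A] {m : ℕ} [NeZero m] (k : ℕ) {L : Language A}
    (h : ∀ u v : List A, RankEquiv k (labelFrom (0 : ZMod m) u) (labelFrom (0 : ZMod m) v) →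
      u ∈ L → v ∈ L) : L ∈ FOLtMod A m := by
  classical
  obtain ⟨T, _, f, hf⟩ := RankEquiv.exists_finite_classifier (A × ZMod m) k
  -- One representative for each of the finitely many values of `f` on `L`; the language is the
  -- union of their classes.
  let I := {t : T // ∃ u ∈ L, f (labelFrom 0 u) = t}
  choose u hu hfu using fun t : I => t.2
  obtain ⟨φ, hφ⟩ := WordDefinable.exists_finite fun t : I =>
    WordDefinable.rankEquiv_segment (A := A) (m := m) k (labelFrom 0 (u t)) (n := 0) none none
  refine ⟨φ, fun w => ?_⟩
  rw [wordSatisfies_iff, ← hφ]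
  have hseg : (labelFrom (0 : ZMod m) w).segment (lowerEnd w Fin.elim0 none)
      (upperEnd w Fin.elim0 none) = labelFrom 0 w := by
    simp [List.segment, lowerEnd, upperEnd]
  simp only [hseg]
  constructor
  · intro hw
    exact ⟨⟨_, w, hw, rfl⟩, hf _ _ (hfu _)⟩
  · rintro ⟨t, ht⟩
    exact h _ _ ht (hu t)

end Definable

/-! ### The stable semigroup and necessity. -/

section Stable

variable {A M : Type*} [Monoid M]

/-- From exponent `a` on, the powers have period `p + 1`; the exponent `(a + 1) * (p + 1)` is a
multiple of this period beyond `a`. -/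
theorem exists_isIdempotentElem_pow [Finite M] (x : M) :
    ∃ n : ℕ, 0 < n ∧ IsIdempotentElem (x ^ n) := by
  obtain ⟨a, b, hne, hab⟩ := Finite.exists_ne_map_eq_of_infinite (fun n : ℕ => x ^ n)
  wlog hlt : a < b generalizing a b
  · exact this b a hne.symm hab.symm (by omega)
  obtain ⟨p, rfl⟩ := Nat.exists_eq_add_of_lt hlt
  have hper : ∀ k, x ^ (a + k * (p + 1)) = x ^ a := by
    intro k
    induction k with
    | zero => simp
    | succ k ih =>
      have : a + (k + 1) * (p + 1) = (a + k * (p + 1)) + (p + 1) := by ring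
      rw [this, pow_add, ih, ← pow_add]
      exact hab.symm
  refine ⟨(a + 1) * (p + 1), by positivity, ?_⟩
  obtain ⟨c, hc⟩ : ∃ c, (a + 1) * (p + 1) = a + c := ⟨a * p + p + 1, by ring⟩
  have : (a + 1) * (p + 1) + (a + 1) * (p + 1) = (a + (a + 1) * (p + 1)) + c := by omega
  rw [IsIdempotentElem, ← pow_add, this, pow_add, hper, ← pow_add, hc]

open scoped Pointwise in
-- Stability says that `φ(A^s)` is idempotent under the product of sets.
theorem lengthImage_mul_of_stable {φ : FreeMonoid A →* M} {s : ℕ}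
    (hs : lengthImage φ s = lengthImage φ (2 * s)) {q : ℕ} (hq : 0 < q) :
    lengthImage φ (s * q) = lengthImage φ s := by
  have hidem : IsIdempotentElem (lengthImage φ s) := by
    change lengthImage φ s * lengthImage φ s = lengthImage φ s
    conv_rhs => rw [hs]
    rw [lengthImage_eq_pow φ s, lengthImage_eq_pow φ (2 * s), two_mul, pow_add]
  rw [lengthImage_eq_pow, pow_mul, ← lengthImage_eq_pow, hidem.pow_eq hq.ne']

/-- The stable semigroup consists of the images of the words of length `s * q`, for a suitable `s`
and every `q > 0`. -/
theorem exists_mem_stableSemigroup_iff [Finite M] (φ : FreeMonoid A →* M) :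
    ∃ s, 0 < s ∧ ∀ q, 0 < q → ∀ x, x ∈ stableSemigroup φ ↔ x ∈ lengthImage φ (s * q) := by
  obtain ⟨s, hs0, hs, hS⟩ := (existsUnique_isStableSemigroup φ).choose_spec.1
  refine ⟨s, hs0, fun q hq x => ?_⟩
  rw [lengthImage_mul_of_stable hs hq, ← hS]
  rfl

theorem FreeMonoid.toList_pow_eq_flatten (w : FreeMonoid A) (n : ℕ) :
    FreeMonoid.toList (w ^ n) = (List.replicate n (FreeMonoid.toList w)).flatten := by
  induction n with
  | zero => simp
  | succ n ih => simp [pow_succ', List.replicate_succ, ih]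

theorem isQA_of_mem_FOLtMod {m : ℕ} (hm : 0 < m) [Finite A] {L : Language A}
    (h : L ∈ FOLtMod A m) : IsQA (syntacticMorphism L) := by
  have : NeZero m := ⟨hm.ne'⟩
  obtain ⟨φ, hφ⟩ := h
  obtain ⟨k, hk⟩ := exists_wordSatisfies_iff m φ
  -- The left context shifts the labels by any `r`; equal lengths modulo `m` keep the labels of the
  -- right context.
  have hcon : ∀ u v : FreeMonoid A,
      ((FreeMonoid.toList u).length : ZMod m) = (FreeMonoid.toList v).length →
      (∀ r : ZMod m, RankEquiv k (labelFrom r (FreeMonoid.toList u))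
        (labelFrom r (FreeMonoid.toList v))) →
      syntacticMorphism L u = syntacticMorphism L v := by
    refine fun u v hlen huv => (Con.eq _).2 fun x y => ?_
    rw [hφ, hφ]
    apply hk
    simp only [FreeMonoid.toList_mul, labelFrom_append, List.length_append, Nat.cast_add, hlen]
    exact ((RankEquiv.refl _ _).append (huv _)).append (.refl _ _)
  have hsurj : Function.Surjective (syntacticMorphism L) := Con.mk'_surjective
  have hfin : Finite (SyntacticMonoid L) := by
    obtain ⟨T, _, f, hf⟩ := RankEquiv.exists_finite_classifier (A × ZMod m) k
    let g : FreeMonoid A → ZMod m × (ZMod m → T) := fun w =>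
      ((FreeMonoid.toList w).length, fun r => f (labelFrom r (FreeMonoid.toList w)))
    refine Finite.of_injective (fun x => g (Function.surjInv hsurj x)) fun x y hxy => ?_
    rw [← Function.surjInv_eq hsurj x, ← Function.surjInv_eq hsurj y]
    obtain ⟨h₁, h₂⟩ := Prod.ext_iff.1 hxy
    exact hcon _ _ h₁ fun r => hf _ _ (congrFun h₂ r)
  refine ⟨hsurj, hfin, fun x hx n hn hidem => ?_⟩
  obtain ⟨s, hs, hS⟩ := exists_mem_stableSemigroup_iff (syntacticMorphism L)
  -- Taking `q = m` represents `x` by a word of length divisible by `m`.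
  obtain ⟨w, hw, rfl⟩ := (hS m hm x).1 hx
  have hw0 : ((FreeMonoid.toList w).length : ZMod m) = 0 := by
    have : (FreeMonoid.toList w).length = s * m := hw
    rw [this]
    simp
  have hpow : syntacticMorphism L w ^ (2 ^ k + 1) = syntacticMorphism L w ^ 2 ^ k := by
    rw [← map_pow, ← map_pow]
    refine hcon _ _ ?_ fun r => ?_
    · simp [FreeMonoid.toList_pow_eq_flatten, hw0]
    · rw [FreeMonoid.toList_pow_eq_flatten, FreeMonoid.toList_pow_eq_flatten,
        labelFrom_flatten_replicate r hw0, labelFrom_flatten_replicate r hw0]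
      exact RankEquiv.flatten_replicate k _
        (.inr ⟨(Nat.sub_le _ _).trans (Nat.le_succ _), Nat.sub_le _ _⟩)
  -- The idempotent `x ^ n` equals `x ^ (n * 2 ^ k)`, whose exponent is in the stabilized range.
  obtain ⟨t, ht⟩ : ∃ t, n * 2 ^ k = 2 ^ k + t :=
    Nat.exists_eq_add_of_le (Nat.le_mul_of_pos_left _ hn)
  rw [← hidem.pow_eq (n := 2 ^ k) (by positivity), ← pow_mul, ht, pow_add, ← mul_assoc,
    ← pow_succ', hpow]

end Stable

/-! ### The partial action of labelled letters and sufficiency. -/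

section LabelAction

theorem Function.End.mul_apply {α : Type*} (f g : Function.End α) (x : α) :
    (f * g) x = f (g x) := rfl

theorem Function.End.one_apply {α : Type*} (x : α) : (1 : Function.End α) x = x := rfl

variable {A M : Type*} [Monoid M] {m : ℕ}

open Classical in
/-- The action of a letter `a` with label `i`, from the left: `(x, i + 1)` becomes `(φ a * x, i)`
and the other pairs become undefined. -/
noncomputable def labelStep (φ : FreeMonoid A →* M) (c : A × ZMod m) :
    Function.End (Option (M × ZMod m)) := fun st =>
  st.bind fun p => if c.2 + 1 = p.2 then some (φ (FreeMonoid.of c.1) * p.1, c.2) else none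

/-- The action of a word of labelled letters. -/
noncomputable def labelAct (φ : FreeMonoid A →* M) (W : List (A × ZMod m)) :
    Function.End (Option (M × ZMod m)) :=
  (W.map (labelStep φ)).prod

/-- The image of the word that remains when the labels are removed. -/
def unlabel (φ : FreeMonoid A →* M) (W : List (A × ZMod m)) : M :=
  φ (FreeMonoid.ofList (W.map Prod.fst))

variable {φ : FreeMonoid A →* M}

theorem unlabel_labelFrom (r : ZMod m) (w : List A) :
    unlabel φ (labelFrom r w) = φ (FreeMonoid.ofList w) := by
  rw [unlabel]
  congr 2
  induction w generalizing r with
  | nil => rfl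
  | cons a w ih => simp [labelFrom, ih]

theorem unlabel_cons (c : A × ZMod m) (W : List (A × ZMod m)) :
    unlabel φ (c :: W) = φ (FreeMonoid.of c.1) * unlabel φ W := by
  simp [unlabel]

theorem labelAct_cons (c : A × ZMod m) (W : List (A × ZMod m)) (st : Option (M × ZMod m)) :
    labelAct φ (c :: W) st = labelStep φ c (labelAct φ W st) := by
  rw [labelAct, List.map_cons, List.prod_cons, Function.End.mul_apply, labelAct]

theorem labelAct_none (W : List (A × ZMod m)) : labelAct φ W none = none := by
  induction W with
  | nil => rfl
  | cons c W ih => rw [labelAct_cons, ih]; rfl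

theorem labelStep_eq_some {c : A × ZMod m} {x : M} {j : ZMod m} {p : M × ZMod m}
    (h : labelStep φ c (some (x, j)) = some p) :
    c.2 + 1 = j ∧ p = (φ (FreeMonoid.of c.1) * x, c.2) := by
  by_cases hj : c.2 + 1 = j
  · simp only [labelStep, Option.bind_some, if_pos hj, Option.some.injEq] at h
    exact ⟨hj, h.symm⟩
  · simp [labelStep, hj] at h

/-- Definedness depends on the labels alone, so one value determines the action on the whole fibre
over `j`; each letter lowers the residue by one. -/
theorem labelAct_eq_some {W : List (A × ZMod m)} {x : M} {j : ZMod m} {p : M × ZMod m}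
    (h : labelAct φ W (some (x, j)) = some p) :
    p.2 + (W.length : ZMod m) = j ∧
      ∀ x', labelAct φ W (some (x', j)) = some (unlabel φ W * x', p.2) := by
  induction W generalizing p with
  | nil =>
    obtain rfl : (x, j) = p := Option.some.inj h
    exact ⟨by simp, fun x' => by simp [labelAct, unlabel, Function.End.one_apply]⟩
  | cons c W ih =>
    rw [labelAct_cons] at h
    cases hW : labelAct φ W (some (x, j)) with
    | none => rw [hW] at h; cases h
    | some q =>
      obtain ⟨h₁, h₂⟩ := ih hW
      rw [hW] at h
      obtain ⟨hc, rfl⟩ := labelStep_eq_some h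
      refine ⟨by rw [← h₁, ← hc, List.length_cons]; push_cast; ring, fun x' => ?_⟩
      rw [labelAct_cons, h₂, unlabel_cons]
      simp [labelStep, hc, mul_assoc]

theorem labelAct_cons_snd {c : A × ZMod m} {W : List (A × ZMod m)} {st : Option (M × ZMod m)}
    {p : M × ZMod m} (h : labelAct φ (c :: W) st = some p) : p.2 = c.2 := by
  rw [labelAct_cons] at h
  cases hW : labelAct φ W st with
  | none => rw [hW] at h; cases h
  | some q =>
    rw [hW] at h
    rw [(labelStep_eq_some h).2]

/-- A correctly labelled word, read from the right, always meets the expected residue, so `φ(w)` can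
be recovered from its action. -/
theorem labelAct_labelFrom (r : ZMod m) (w : List A) (x : M) :
    labelAct φ (labelFrom r w) (some (x, r + (w.length : ZMod m))) =
      some (φ (FreeMonoid.ofList w) * x, r) := by
  induction w generalizing r with
  | nil => simp [labelFrom, labelAct, Function.End.one_apply]
  | cons a w ih =>
    have e : r + ((a :: w).length : ZMod m) = r + 1 + (w.length : ZMod m) := by
      rw [List.length_cons]; push_cast; ring
    rw [labelFrom, labelAct_cons, e, ih]
    simp [labelStep, mul_assoc]

theorem labelAct_pow_apply {W : List (A × ZMod m)} {x : M} {j : ZMod m} {y : M}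
    (h : labelAct φ W (some (x, j)) = some (y, j)) (n : ℕ) :
    (labelAct φ W ^ n) (some (x, j)) = some (unlabel φ W ^ n * x, j) := by
  induction n with
  | zero => simp [Function.End.one_apply]
  | succ n ih =>
    rw [pow_succ', Function.End.mul_apply, ih, (labelAct_eq_some h).2,
      pow_succ', mul_assoc]

/-- A word acts aperiodically when the powers of its unlabelled image stabilize, in case its length
is a multiple of `m`. -/
theorem exists_labelAct_pow_succ {W : List (A × ZMod m)}
    (h : (W.length : ZMod m) = 0 → ∃ n, unlabel φ W ^ (n + 1) = unlabel φ W ^ n) :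
    ∃ n, labelAct φ W ^ (n + 1) = labelAct φ W ^ n := by
  have pow_none : ∀ n, (labelAct φ W ^ n) none = none := fun n => by
    induction n with
    | zero => rfl
    | succ n ih => rw [pow_succ', Function.End.mul_apply, ih, labelAct_none]
  have undef : ∀ n st, labelAct φ W st = none → (labelAct φ W ^ (n + 1)) st = none := by
    intro n st hst
    rw [pow_succ, Function.End.mul_apply, hst, pow_none]
  by_cases hW : (W.length : ZMod m) = 0
  · obtain ⟨n, hn⟩ := h hW
    -- The extra factor makes both powers undefined wherever `W` is, even for `n = 0`.
    refine ⟨n + 1, funext fun st => ?_⟩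
    cases hst : labelAct φ W st with
    | none => rw [undef _ _ hst, undef _ _ hst]
    | some p =>
      match st, hst with
      | none, hst => rw [labelAct_none] at hst; cases hst
      | some (x, j), hst =>
        obtain ⟨y, i⟩ := p
        obtain rfl : i = j := by simpa [hW] using (labelAct_eq_some hst).1
        rw [labelAct_pow_apply hst, labelAct_pow_apply hst, pow_succ' _ (n + 1), hn, ← pow_succ', hn]
  -- Any value of `W` carries the label `i` of its first letter; a second application would need `i
  -- + W.length = i`.
  · have sq : ∀ st, labelAct φ W (labelAct φ W st) = none := by
      intro st
      by_contra hne
      obtain ⟨q, hq⟩ := Option.ne_none_iff_exists'.1 hne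
      cases hst : labelAct φ W st with
      | none => rw [hst, labelAct_none] at hq; cases hq
      | some p =>
        rw [hst] at hq
        cases W with
        | nil => simp at hW
        | cons c W =>
          have h₁ := labelAct_cons_snd hst
          have h₂ := labelAct_cons_snd hq
          have h₃ := (labelAct_eq_some (x := p.1) (j := p.2) hq).1
          rw [h₁, h₂] at h₃
          exact hW (by simpa using h₃)
    refine ⟨2, funext fun st => ?_⟩
    have e : ∀ n, (labelAct φ W ^ (n + 2)) st = none := fun n => by
      rw [pow_add, pow_two, Function.End.mul_apply, Function.End.mul_apply, sq, pow_none]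
    exact (e 1).trans (e 0).symm

end LabelAction

/-- `Synt(L)` itself may contain groups, so Schützenberger's theorem is applied to the monoid
generated by the labelled letters. -/
theorem exists_mem_FOLtMod_of_isQA {A : Type*} [Finite A] {L : Language A}
    (h : IsQA (syntacticMorphism L)) : ∃ m : ℕ, 1 < m ∧ L ∈ FOLtMod A m := by
  obtain ⟨-, _, hap⟩ := h
  obtain ⟨s, hs, hS⟩ := exists_mem_stableSemigroup_iff (syntacticMorphism L)
  have : NeZero (s * 2) := ⟨by omega⟩
  -- The factor 2 ensures a modulus above 1 when `s = 1`.
  refine ⟨s * 2, by omega, ?_⟩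
  let η := syntacticMorphism L
  let step : A × ZMod (s * 2) → Function.End (Option (SyntacticMonoid L × ZMod (s * 2))) :=
    labelStep η
  let N := MonoidHom.mrange (FreeMonoid.lift step)
  have : Finite (Function.End (Option (SyntacticMonoid L × ZMod (s * 2)))) :=
    inferInstanceAs (Finite (Option (SyntacticMonoid L × ZMod (s * 2)) → _))
  obtain ⟨k, hk⟩ := exists_prod_eq_of_rankEquiv (N := N) (by
    rintro ⟨_, W, rfl⟩
    obtain ⟨n, hn⟩ := exists_labelAct_pow_succ (φ := η) (W := FreeMonoid.toList W) (fun hW => by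
      rw [ZMod.natCast_eq_zero_iff] at hW
      obtain ⟨q, hq⟩ := hW
      -- The empty word is separate: its image `1` need not lie in the stable semigroup.
      rcases Nat.eq_zero_or_pos q with rfl | hq0
      · refine ⟨0, ?_⟩
        have : FreeMonoid.toList W = [] := List.length_eq_zero_iff.1 (by simpa using hq)
        simp [unlabel, this]
      · obtain ⟨n, hn, hidem⟩ := exists_isIdempotentElem_pow (unlabel η (FreeMonoid.toList W))
        refine ⟨n, (pow_succ' _ _).trans (hap _ ?_ n hn hidem)⟩
        refine (hS (2 * q) (by omega) _).2 ⟨_, ?_, rfl⟩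
        change (List.map Prod.fst (FreeMonoid.toList W)).length = _
        rw [List.length_map, hq, mul_assoc])
    refine ⟨n, Subtype.ext ?_⟩
    have e : FreeMonoid.lift step W = labelAct η (FreeMonoid.toList W) :=
      FreeMonoid.lift_apply _ _
    change FreeMonoid.lift step W ^ (n + 1) = FreeMonoid.lift step W ^ n
    rw [e]
    exact hn)
  refine mem_FOLtMod_of_rankEquiv k fun u v huv hu => ?_
  let g : A × ZMod (s * 2) → N := fun c => ⟨step c, FreeMonoid.of c, by simp⟩
  have hval : ∀ W, ((W.map g).prod : N).1 = labelAct η W := fun W => by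
    rw [Submonoid.coe_list_prod, List.map_map]
    rfl
  have hact := congrArg Subtype.val (hk _ _ (huv.map g))
  rw [hval, hval] at hact
  -- The common action, evaluated at `1` over the residue of `u.length`, gives `η u` through `u` and
  -- `η v` through `v`.
  have hu' := labelAct_labelFrom (φ := η) (0 : ZMod (s * 2)) u 1
  rw [hact] at hu'
  have hη := (labelAct_eq_some hu').2 1
  rw [hu', unlabel_labelFrom, mul_one, mul_one] at hη
  have hcon := (Con.eq _).1 (Prod.ext_iff.1 (Option.some.inj hη)).1
  simpa using (hcon 1 1).1 (by simpa using hu)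

theorem theorem3p5 {A : Type*} [Finite A] (L : Language A) :
    (∃ m : ℕ, 1 < m ∧ L ∈ FOLtMod A m) ↔ IsQA (syntacticMorphism L) :=
  ⟨fun ⟨_, hm, h⟩ => isQA_of_mem_FOLtMod (by omega) h, exists_mem_FOLtMod_of_isQA⟩
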